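/- Let $f:\mathbb R\to\mathbb R$ be continuous, let $\rho>0$, and let $\omega:[0,\rho[\to[0,+\infty[$ be continuous and nondecreasing, with $\omega(x)>0$ for $0<x<\rho$ (as is the case if $\omega$ is strictly increasing), and with $\lim_{\xi\to\rho^-}\int_0^{\xi}\omega(x)\,dx=+\infty$. Consider $C^0([0,1])\times C^0([0,1])$ endowed with the norm $\|(\alpha,\beta)\|=\int_0^1|\alpha(t)|\,dt+\int_0^1|\beta(t)|\,dt$. Then the following assertions are equivalent: (a) the restriction of $f$ to $\left[-\frac{\sqrt\rho}{2},\frac{\sqrt\rho}{2}\right]$ is not constant; (b) for every convex set $S\subseteq C^0([0,1])\times C^0([0,1])$ that is dense in $C^0([0,1])\times C^0([0,1])$ for this norm, there exists $(\alpha,\beta)\in S$ such that the problem $$-\omega\left(\int_0^1|u'(t)|^2dt\right)u''(t)=\beta(t)f(u(t))+\alpha(t)\ \text{ for } t\in[0,1],\qquad u(0)=u(1)=0,\qquad \int_0^1|u'(t)|^2dt<\rho$$ has at least two classical solutions, that is, at least two distinct functions $u\in C^2([0,1])$ satisfying it. -/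

import Mathlib

open Set Filter Topology MeasureTheory

noncomputable section

/-- The norm `‖(α, β)‖ = ∫₀¹ |α(t)| dt + ∫₀¹ |β(t)| dt` on `C⁰([0,1]) × C⁰([0,1])`. -/
def l1Norm (p : C(unitInterval, ℝ) × C(unitInterval, ℝ)) : ℝ :=
  (∫ t : unitInterval, |p.1 t|) + ∫ t : unitInterval, |p.2 t|

/-- `S` is dense in `C⁰([0,1]) × C⁰([0,1])` for the norm `l1Norm`
(not for the uniform topology that `C(unitInterval, ℝ)` carries in Mathlib). -/
def L1Dense (S : Set (C(unitInterval, ℝ) × C(unitInterval, ℝ))) : Prop :=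
  ∀ p : C(unitInterval, ℝ) × C(unitInterval, ℝ), ∀ ε : ℝ, 0 < ε → ∃ q ∈ S, l1Norm (p - q) < ε

/-- The energy `∫₀¹ |u'(t)|² dt`, with `u'` the derivative relative to `[0,1]`
(one-sided at the endpoints). -/
def dirichletEnergy (u : ℝ → ℝ) : ℝ :=
  ∫ t in (0 : ℝ)..1, |derivWithin u (Icc 0 1) t| ^ 2

/-- `u` (only its values on `[0,1]` matter) is a classical solution of
`-ω(∫₀¹ |u'|²) u'' = β(t) f(u) + α(t)` in `[0,1]`, `u(0) = u(1) = 0`, `∫₀¹ |u'|² < ρ`. -/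
structure IsKirchhoffSolution (f ω : ℝ → ℝ) (ρ : ℝ) (α β : C(unitInterval, ℝ))
    (u : ℝ → ℝ) : Prop where
  contDiffOn : ContDiffOn ℝ 2 u (Icc 0 1)
  equation : ∀ t : unitInterval,
    -ω (dirichletEnergy u) * iteratedDerivWithin 2 u (Icc 0 1) t = β t * f (u t) + α t
  left_zero : u 0 = 0
  right_zero : u 1 = 0
  energy_lt : dirichletEnergy u < ρ

end

/-!
The solutions of the problem are the critical points of
`J(u) = W(∫₀¹ |u'|²) / 2 - ∫₀¹ α u - ∫₀¹ β F(u)` on the ball `∫₀¹ |u'|² < ρ` of `H¹₀(0, 1)`, where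
`W' = ω` and `F' = f`; functions in this ball satisfy `|u| < √ρ / 2`.

If `f` is not constant on `[-√ρ/2, √ρ/2]`, then `F` is not midpoint affine there, and tent functions
`u₁`, `u₂` show that the midpoint `(a, b)` of `(u₁, F(u₁))` and `(u₂, F(u₂))` is not of the form
`(u, F(u))`. For `S` convex and dense, consider
`W(∫₀¹ |u'|²) / 2 - ∫₀¹ α (u - a) - ∫₀¹ β (F(u) - b)`, which is affine in `(α, β)`. For every
`(α, β)` its infimum over `u` is at most its average `c` over `u₁` and `u₂`, which does not depend on
`(α, β)`. If for each `(α, β) ∈ S` there were at most one solution, hence only one minimizer, the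
minimax theorem `exists_forall_le_of_unique_min` would give one `u` at which the functional is at
most `c` for all `(α, β) ∈ S`. Then `(α, β) ↦ ∫₀¹ α (u - a) + ∫₀¹ β (F(u) - b)` is bounded below on a
dense set, so it vanishes (`eq_zero_of_bddBelow_loadPairing`) and `(a, b) = (u, F(u))`, a
contradiction.

Instead of `H¹₀` with its weak topology, the proof uses continuous functions with the topology of
uniform convergence, and describes the Dirichlet energy as a supremum `weakEnergy` of continuous
functions of `u`. Lower semicontinuity is then immediate; step functions among the test functions
give the Hölder estimate needed for compactness (`isCompact_energyDual_le`), and translating the test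
function by `x φ'` bounds the energy of `u + x φ` by a quadratic polynomial in `x`
(`weakEnergy_add_mul_le`), which yields the Euler–Lagrange equation and from it the regularity of
minimizers (`exists_isKirchhoffSolution_of_isMin`).

If `f` is constant on `[-√ρ/2, √ρ/2]`, the right-hand side does not depend on `u`, and the solution
is unique for all `α`, `β` because `ω` is nondecreasing (`eqOn_of_isKirchhoffSolution`).
-/

/-! ### A minimax theorem -/

/-- A function on a nonempty Hausdorff space with compact sublevel sets attains its minimum. -/
theorem exists_forall_le_of_isCompact_sublevel {X : Type*} [TopologicalSpace X] [T2Space X]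
    [Nonempty X] {J : X → ℝ} (hJ : ∀ c, IsCompact {x | J x ≤ c}) : ∃ x, ∀ z, J x ≤ J z := by
  obtain ⟨x₀⟩ := ‹Nonempty X›
  have hlsc : LowerSemicontinuous J :=
    lowerSemicontinuous_iff_isClosed_preimage.2 fun c => (hJ c).isClosed
  obtain ⟨x, hx, hmin⟩ := (hlsc.lowerSemicontinuousOn {x | J x ≤ J x₀}).exists_isMinOn
    ⟨x₀, le_refl (J x₀)⟩ (hJ _)
  refine ⟨x, fun z => ?_⟩
  by_cases hz : J z ≤ J x₀
  · exact hmin hz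
  · exact le_trans hx (not_le.1 hz).le

section Minimax

variable {X V : Type*} [TopologicalSpace X] [T2Space X] [Nonempty X] [AddCommGroup V] [Module ℝ V]
  {S : Set V} {I : X → ℝ} {ℓ : X → V →ₗ[ℝ] ℝ} {c : ℝ}

/-- The minimax inequality over finitely many parameters. The point `x` is the minimizer of
`I + ℓ · y` for the parameter `y` in the simplex spanned by the `y i` at which the minimum value
is largest. -/
theorem exists_forall_le_of_unique_min_of_finite {ι : Type*} [Fintype ι] [Nonempty ι]
    (hS : Convex ℝ S)
    (hcomp : ∀ y ∈ S, ∀ r, IsCompact {x | I x + ℓ x y ≤ r})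
    (huniq : ∀ y ∈ S, ∀ x x', (∀ z, I x + ℓ x y ≤ I z + ℓ z y) →
      (∀ z, I x' + ℓ x' y ≤ I z + ℓ z y) → x = x')
    (hc : ∀ y ∈ S, ∃ x, I x + ℓ x y ≤ c) (y : ι → V) (hy : ∀ i, y i ∈ S) :
    ∃ x, ∀ i, I x + ℓ x (y i) ≤ c := by
  classical
  set Y : (ι → ℝ) → V := fun w => ∑ i, w i • y i with hYdef
  have hYS : ∀ w ∈ stdSimplex ℝ ι, Y w ∈ S := fun w hw =>
    hS.sum_mem (fun i _ => hw.1 i) hw.2 (fun i _ => hy i)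
  have hYc : ∀ x, Continuous fun w => I x + ℓ x (Y w) := by
    intro x
    simp only [hYdef, map_sum, map_smul, smul_eq_mul]
    fun_prop
  choose! m hm using fun w (hw : w ∈ stdSimplex ℝ ι) =>
    exists_forall_le_of_isCompact_sublevel (hcomp (Y w) (hYS w hw))
  have husc : UpperSemicontinuousOn (fun w => I (m w) + ℓ (m w) (Y w)) (stdSimplex ℝ ι) := by
    intro w hw r hr
    filter_upwards [self_mem_nhdsWithin,
      nhdsWithin_le_nhds ((hYc (m w)).continuousAt.eventually (gt_mem_nhds hr))] with w' hw' hlt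
    exact (hm w' hw' (m w)).trans_lt hlt
  obtain ⟨w, hw, hmax⟩ := husc.exists_isMaxOn
    (⟨_, single_mem_stdSimplex ℝ (Classical.arbitrary ι)⟩ : (stdSimplex ℝ ι).Nonempty)
    (isCompact_stdSimplex ℝ ι)
  set γ := I (m w) + ℓ (m w) (Y w) with hγ
  have hγc : γ ≤ c := by
    obtain ⟨x, hx⟩ := hc (Y w) (hYS w hw)
    exact (hm w hw x).trans hx
  refine ⟨m w, fun i => le_trans ?_ hγc⟩
  -- Along the segment from `Y w` to `y i`, the minimizers lie in the `γ`-sublevel set of `y i`.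
  have key : ∀ t : ℝ, 0 < t → t ≤ 1 → ∃ x, I x + ℓ x (y i) ≤ γ ∧
      (1 - t) * (I x + ℓ x (Y w)) + t * (I x + ℓ x (y i)) ≤ γ := by
    intro t ht ht1
    set w' : ι → ℝ := (1 - t) • w + t • Pi.single i 1 with hw'def
    have hw' : w' ∈ stdSimplex ℝ ι := (convex_stdSimplex ℝ ι) hw (single_mem_stdSimplex ℝ i)
      (by linarith) ht.le (by ring)
    have hYw' : Y w' = (1 - t) • Y w + t • y i := by
      simp only [hYdef, hw'def, Pi.add_apply, Pi.smul_apply, smul_eq_mul, add_smul, mul_smul,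
        Finset.sum_add_distrib, ← Finset.smul_sum]
      congr 2
      rw [Finset.sum_eq_single i] <;> simp +contextual
    have h1 : I (m w') + ℓ (m w') (Y w') ≤ γ := hmax hw'
    have h2 : γ ≤ I (m w') + ℓ (m w') (Y w) := hm w hw (m w')
    rw [hYw', map_add, map_smul, map_smul, smul_eq_mul, smul_eq_mul] at h1
    refine ⟨m w', ?_, by linarith⟩
    have : t * (I (m w') + ℓ (m w') (y i)) ≤ t * γ := by nlinarith
    exact le_of_mul_le_mul_left this ht
  have hKne : {x | I x + ℓ x (y i) ≤ γ}.Nonempty := (key 1 one_pos le_rfl).imp fun x hx => hx.1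
  have hlsc : ∀ z ∈ S, LowerSemicontinuous fun x => I x + ℓ x z := fun z hz =>
    lowerSemicontinuous_iff_isClosed_preimage.2 fun r => (hcomp z hz r).isClosed
  obtain ⟨x₀, hx₀, hx₀min⟩ := ((hlsc _ (hYS w hw)).lowerSemicontinuousOn _).exists_isMinOn
    hKne (hcomp (y i) (hy i) γ)
  obtain ⟨b, hb⟩ := exists_forall_le_of_isCompact_sublevel (hcomp (y i) (hy i))
  -- Letting the parameter tend to `Y w`, the minimizer of `Y w` is in that sublevel set too.
  have hle : I x₀ + ℓ x₀ (Y w) ≤ γ := by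
    have hlim : Tendsto (fun t : ℝ => (1 - t) * (I x₀ + ℓ x₀ (Y w)) + t * (I b + ℓ b (y i)))
        (𝓝[>] 0) (𝓝 ((1 - 0) * (I x₀ + ℓ x₀ (Y w)) + 0 * (I b + ℓ b (y i)))) :=
      tendsto_nhdsWithin_of_tendsto_nhds (Continuous.tendsto (by fun_prop) 0)
    rw [sub_zero, one_mul, zero_mul, add_zero] at hlim
    refine le_of_tendsto hlim ?_
    filter_upwards [Ioc_mem_nhdsGT (zero_lt_one' ℝ)] with t ht
    obtain ⟨x, hx1, hx2⟩ := key t ht.1 ht.2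
    have h3 : I x₀ + ℓ x₀ (Y w) ≤ I x + ℓ x (Y w) := hx₀min hx1
    have h4 := hb x
    nlinarith [ht.1, ht.2, mul_le_mul_of_nonneg_left h3 (sub_nonneg.2 ht.2),
      mul_le_mul_of_nonneg_left h4 ht.1.le]
  have := huniq (Y w) (hYS w hw) (m w) x₀ (hm w hw) fun z => hle.trans (hm w hw z)
  rw [this]
  exact hx₀

/-- Minimax inequality for a family of functionals that is affine in a parameter ranging over a
convex set: if all sublevel sets are compact and each functional has only one global minimizer, an
upper bound on all the minimum values is attained at one point simultaneously. -/
theorem exists_forall_le_of_unique_min (hS : Convex ℝ S) (hne : S.Nonempty)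
    (hcomp : ∀ y ∈ S, ∀ r, IsCompact {x | I x + ℓ x y ≤ r})
    (huniq : ∀ y ∈ S, ∀ x x', (∀ z, I x + ℓ x y ≤ I z + ℓ z y) →
      (∀ z, I x' + ℓ x' y ≤ I z + ℓ z y) → x = x')
    (hc : ∀ y ∈ S, ∃ x, I x + ℓ x y ≤ c) :
    ∃ x, ∀ y ∈ S, I x + ℓ x y ≤ c := by
  classical
  obtain ⟨y₀, hy₀⟩ := hne
  obtain ⟨x, -, hx⟩ := (hcomp y₀ hy₀ c).inter_iInter_nonempty
    (fun y : S => {x | I x + ℓ x y ≤ c}) (fun y => (hcomp y y.2 c).isClosed) (by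
      intro T
      have : Nonempty (insert ⟨y₀, hy₀⟩ T : Finset S) := ⟨⟨_, Finset.mem_insert_self _ _⟩⟩
      obtain ⟨x, hx⟩ := exists_forall_le_of_unique_min_of_finite hS hcomp huniq hc
        (fun y : (insert ⟨y₀, hy₀⟩ T : Finset S) => (y : V)) (fun y => y.1.2)
      refine ⟨x, hx ⟨⟨y₀, hy₀⟩, Finset.mem_insert_self _ _⟩, ?_⟩
      simp only [mem_iInter]
      exact fun y hy => hx ⟨y, Finset.mem_insert_of_mem hy⟩)
  exact ⟨x, fun y hy => mem_iInter.1 hx ⟨y, hy⟩⟩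

end Minimax

/-! ### The Dirichlet energy by duality -/

/-- A test function for the Dirichlet energy on `[0,1]`: the sum of a `C¹` function `toFun` and of
the step function equal to `height` on `(left, right]` and to `0` elsewhere. -/
structure EnergyTest where
  toFun : ℝ → ℝ
  height : ℝ
  left : ℝ
  right : ℝ
  contDiff : ContDiff ℝ 1 toFun
  left_nonneg : 0 ≤ left
  left_le_right : left ≤ right
  right_le_one : right ≤ 1

/-- For `h = k + c 1_{(s, t]}` the quantity `-2 ∫₀¹ u dh - ∫₀¹ h²`, where
`-∫₀¹ u dh = -∫₀¹ u k' + c (u t - u s)`. It makes sense for every continuous `u`; if `u` is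
absolutely continuous and vanishes at `0` and `1`, it equals `∫₀¹ (2 u' h - h²)`. -/
noncomputable def energyDual (u : ℝ → ℝ) (h : EnergyTest) : ℝ :=
  -(2 * ∫ x in (0 : ℝ)..1, u x * deriv h.toFun x) + 2 * h.height * (u h.right - u h.left)
    - ((∫ x in (0 : ℝ)..1, h.toFun x ^ 2) + 2 * h.height * (∫ x in h.left..h.right, h.toFun x)
      + h.height ^ 2 * (h.right - h.left))

/-- The supremum of `energyDual u` over all test functions. This is the Dirichlet energy of `u`
when `u` vanishes at `0` and `1`, and the family is bounded above exactly when the energy is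
finite (otherwise the supremum is the junk value `0`). -/
noncomputable def weakEnergy (u : ℝ → ℝ) : ℝ := ⨆ h, energyDual u h

theorem energyDual_le_integral_sq {u v : ℝ → ℝ} (hu : ContinuousOn u (Icc 0 1))
    (huv : ∀ x ∈ Ioo (0 : ℝ) 1, HasDerivWithinAt u (v x) (Ioi x) x)
    (hv : IntervalIntegrable v volume 0 1) (hv2 : IntervalIntegrable (fun x => v x ^ 2) volume 0 1)
    (h0 : u 0 = 0) (h1 : u 1 = 0) (h : EnergyTest) :
    energyDual u h ≤ ∫ x in (0 : ℝ)..1, v x ^ 2 := by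
  obtain ⟨k, c, s, t, hk, hs, hst, ht⟩ := h
  have hkc := hk.continuous
  have hdk : Continuous (deriv k) := hk.continuous_deriv le_rfl
  have hkd : ∀ x, HasDerivAt k (deriv k x) x := fun x =>
    (hk.differentiable one_ne_zero x).hasDerivAt
  have e1 : ∫ x in (0 : ℝ)..1, u x * deriv k x = - ∫ x in (0 : ℝ)..1, v x * k x := by
    rw [intervalIntegral.integral_mul_deriv_eq_deriv_mul_of_hasDeriv_right (u := u) (v := k)
      (u' := v) (v' := deriv k) (by rwa [uIcc_of_le zero_le_one]) hkc.continuousOn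
      (by simpa using huv) (fun x _ => (hkd x).hasDerivWithinAt) hv (hdk.intervalIntegrable _ _),
      h0, h1]
    ring
  have hsub : uIcc s t ⊆ uIcc 0 1 := by
    rw [uIcc_of_le hst, uIcc_of_le zero_le_one]
    exact Icc_subset_Icc hs ht
  have hvst := hv.mono_set hsub
  have e2 : u t - u s = ∫ x in s..t, v x := by
    refine (intervalIntegral.integral_eq_sub_of_hasDeriv_right_of_le hst
      (hu.mono (Icc_subset_Icc hs ht)) (fun x hx => huv x ⟨hs.trans_lt hx.1, hx.2.trans_le ht⟩)
      hvst).symm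
  have hvk : IntervalIntegrable (fun x => v x * k x) volume 0 1 := hv.mul_continuousOn
    hkc.continuousOn
  have hk2 : IntervalIntegrable (fun x => k x ^ 2) volume 0 1 := (hkc.pow 2).intervalIntegrable _ _
  have hsq : IntervalIntegrable (fun x => v x ^ 2 - 2 * (v x * k x) + k x ^ 2) volume 0 1 :=
    (hv2.sub (hvk.const_mul 2)).add hk2
  have e3 : ∫ x in (0 : ℝ)..1, (v x ^ 2 - 2 * (v x * k x) + k x ^ 2) =
      (∫ x in (0 : ℝ)..1, v x ^ 2) - 2 * (∫ x in (0 : ℝ)..1, v x * k x)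
        + ∫ x in (0 : ℝ)..1, k x ^ 2 := by
    rw [intervalIntegral.integral_add (hv2.sub (hvk.const_mul 2)) hk2,
      intervalIntegral.integral_sub hv2 (hvk.const_mul 2), intervalIntegral.integral_const_mul]
  have e4 : ∫ x in s..t, (v x ^ 2 - 2 * (v x * k x) + k x ^ 2) ≤
      ∫ x in (0 : ℝ)..1, (v x ^ 2 - 2 * (v x * k x) + k x ^ 2) :=
    intervalIntegral.integral_mono_interval hs hst ht
      (ae_of_all _ fun x => by simp only [Pi.zero_apply]; nlinarith [sq_nonneg (v x - k x)]) hsq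
  have e5 : ∫ x in s..t, (2 * c * v x - 2 * c * k x - c ^ 2) ≤
      ∫ x in s..t, (v x ^ 2 - 2 * (v x * k x) + k x ^ 2) := by
    refine intervalIntegral.integral_mono_on hst
      (((hvst.const_mul _).sub ((hkc.intervalIntegrable _ _).const_mul _)).sub
        intervalIntegrable_const) (hsq.mono_set hsub) fun x _ => ?_
    nlinarith [sq_nonneg (v x - k x - c)]
  have e6 : ∫ x in s..t, (2 * c * v x - 2 * c * k x - c ^ 2) =
      2 * c * (∫ x in s..t, v x) - 2 * c * (∫ x in s..t, k x) - c ^ 2 * (t - s) := by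
    rw [intervalIntegral.integral_sub ((hvst.const_mul _).sub
      ((hkc.intervalIntegrable _ _).const_mul _)) intervalIntegrable_const,
      intervalIntegral.integral_sub (hvst.const_mul _) ((hkc.intervalIntegrable _ _).const_mul _),
      intervalIntegral.integral_const_mul, intervalIntegral.integral_const_mul,
      intervalIntegral.integral_const, smul_eq_mul]
    ring
  simp only [energyDual, e1, e2]
  linarith

/-- Adding `x • φ` to `u` amounts to adding the explicit quadratic polynomial in `x` to the energy
once the test function is translated by `x • φ'`. -/
theorem exists_energyDual_add_mul {u φ φ' φ'' : ℝ → ℝ} (hu : Continuous u)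
    (hφ : ∀ x, HasDerivAt φ (φ' x) x) (hφ' : ∀ x, HasDerivAt φ' (φ'' x) x)
    (hφ'' : Continuous φ'') (h0 : φ 0 = 0) (h1 : φ 1 = 0) (x : ℝ) (h : EnergyTest) :
    ∃ h' : EnergyTest, energyDual (fun t => u t + x * φ t) h = energyDual u h'
      - 2 * x * (∫ t in (0 : ℝ)..1, u t * φ'' t) + x ^ 2 * ∫ t in (0 : ℝ)..1, φ' t ^ 2 := by
  obtain ⟨k, c, s, t, hk, hs, hst, ht⟩ := h
  have hφc : Continuous φ := continuous_iff_continuousAt.2 fun y => (hφ y).continuousAt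
  have hφ'c : Continuous φ' := continuous_iff_continuousAt.2 fun y => (hφ' y).continuousAt
  have hdφ' : deriv φ' = φ'' := funext fun y => (hφ' y).deriv
  have hC1 : ContDiff ℝ 1 φ' := contDiff_one_iff_deriv.2
    ⟨fun y => (hφ' y).differentiableAt, by rwa [hdφ']⟩
  have hkc := hk.continuous
  have hdk : Continuous (deriv k) := hk.continuous_deriv le_rfl
  have hkd : ∀ y, HasDerivAt k (deriv k y) y := fun y =>
    (hk.differentiable one_ne_zero y).hasDerivAt
  refine ⟨⟨fun y => k y - x * φ' y, c, s, t, hk.sub (contDiff_const.mul hC1), hs, hst, ht⟩, ?_⟩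
  have hd : deriv (fun y => k y - x * φ' y) = fun y => deriv k y - x * φ'' y :=
    funext fun y => ((hkd y).sub ((hφ' y).const_mul x)).deriv
  have i1 : IntervalIntegrable (fun y => u y * deriv k y) volume 0 1 :=
    (hu.mul hdk).intervalIntegrable _ _
  have i2 : IntervalIntegrable (fun y => φ y * deriv k y) volume 0 1 :=
    (hφc.mul hdk).intervalIntegrable _ _
  have i3 : IntervalIntegrable (fun y => u y * φ'' y) volume 0 1 :=
    (hu.mul hφ'').intervalIntegrable _ _
  have i4 : IntervalIntegrable (fun y => k y ^ 2) volume 0 1 := (hkc.pow 2).intervalIntegrable _ _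
  have i5 : IntervalIntegrable (fun y => φ' y * k y) volume 0 1 :=
    (hφ'c.mul hkc).intervalIntegrable _ _
  have i6 : IntervalIntegrable (fun y => φ' y ^ 2) volume 0 1 :=
    (hφ'c.pow 2).intervalIntegrable _ _
  have e1 : ∫ y in (0 : ℝ)..1, (u y + x * φ y) * deriv k y =
      (∫ y in (0 : ℝ)..1, u y * deriv k y) + x * ∫ y in (0 : ℝ)..1, φ y * deriv k y := by
    rw [← intervalIntegral.integral_const_mul, ← intervalIntegral.integral_add i1 (i2.const_mul x)]
    exact intervalIntegral.integral_congr fun y _ => by ring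
  have e2 : ∫ y in (0 : ℝ)..1, φ y * deriv k y = - ∫ y in (0 : ℝ)..1, φ' y * k y := by
    rw [intervalIntegral.integral_mul_deriv_eq_deriv_mul (fun y _ => hφ y) (fun y _ => hkd y)
      (hφ'c.intervalIntegrable _ _) (hdk.intervalIntegrable _ _), h0, h1]
    ring
  have e3 : ∫ y in (0 : ℝ)..1, u y * (deriv k y - x * φ'' y) =
      (∫ y in (0 : ℝ)..1, u y * deriv k y) - x * ∫ y in (0 : ℝ)..1, u y * φ'' y := by
    rw [← intervalIntegral.integral_const_mul, ← intervalIntegral.integral_sub i1 (i3.const_mul x)]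
    exact intervalIntegral.integral_congr fun y _ => by ring
  have e4 : ∫ y in (0 : ℝ)..1, (k y - x * φ' y) ^ 2 =
      (∫ y in (0 : ℝ)..1, k y ^ 2) - 2 * x * (∫ y in (0 : ℝ)..1, φ' y * k y)
        + x ^ 2 * ∫ y in (0 : ℝ)..1, φ' y ^ 2 := by
    rw [← intervalIntegral.integral_const_mul, ← intervalIntegral.integral_const_mul,
      ← intervalIntegral.integral_sub i4 (i5.const_mul _),
      ← intervalIntegral.integral_add (i4.sub (i5.const_mul _)) (i6.const_mul _)]
    exact intervalIntegral.integral_congr fun y _ => by ring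
  have e5 : ∫ y in s..t, (k y - x * φ' y) = (∫ y in s..t, k y) - x * (φ t - φ s) := by
    rw [intervalIntegral.integral_sub (hkc.intervalIntegrable _ _)
      ((hφ'c.intervalIntegrable _ _).const_mul x), intervalIntegral.integral_const_mul,
      intervalIntegral.integral_eq_sub_of_hasDerivAt (fun y _ => hφ y)
      (hφ'c.intervalIntegrable _ _)]
  simp only [energyDual, hd, e1, e2, e3, e4, e5]
  ring

theorem sq_sub_le_of_energyDual_le {u : ℝ → ℝ} {r : ℝ} (hr : ∀ h, energyDual u h ≤ r) {s t : ℝ}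
    (hs : 0 ≤ s) (hst : s ≤ t) (ht : t ≤ 1) : (u t - u s) ^ 2 ≤ r * (t - s) := by
  rcases hst.eq_or_lt with rfl | hlt
  · simp
  have h := hr ⟨fun _ => 0, (u t - u s) / (t - s), s, t, contDiff_const, hs, hst, ht⟩
  have hpos : 0 < t - s := sub_pos.2 hlt
  simp only [energyDual, deriv_const, mul_zero, intervalIntegral.integral_zero, ne_eq,
    OfNat.ofNat_ne_zero, not_false_eq_true, zero_pow, neg_zero, zero_add] at h
  field_simp at h
  nlinarith

/-- The constant `1/4` is the maximum of `t (1 - t)` on `[0, 1]`; it relates the energy bound `ρ` to the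
interval `[-√ρ/2, √ρ/2]`. -/
theorem sq_le_of_energyDual_le {u : ℝ → ℝ} {r : ℝ} (hr : ∀ h, energyDual u h ≤ r) (h0 : u 0 = 0)
    {t : ℝ} (ht : t ∈ Icc (0 : ℝ) 1) : u t ^ 2 ≤ r / 4 := by
  -- The test function with jump `c` on `(0, t]` and mean zero: the derivative, up to a factor, of
  -- the extremal tent function with vertex at `t`.
  set c := 4 * u t with hc
  have h := hr ⟨fun _ => -(c * t), c, 0, t, contDiff_const, le_rfl, ht.1, ht.2⟩
  simp only [energyDual, deriv_const, mul_zero, intervalIntegral.integral_zero, neg_zero, zero_add,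
    intervalIntegral.integral_const, smul_eq_mul, h0, sub_zero, one_mul] at h
  nlinarith [mul_nonneg (sq_nonneg c) (sq_nonneg (t - 1 / 2))]

theorem exists_energyDual_eq_zero (u : ℝ → ℝ) :
    ∃ h, energyDual u h = 0 :=
  ⟨⟨fun _ => 0, 0, 0, 0, contDiff_const, le_rfl, le_rfl, zero_le_one⟩, by simp [energyDual]⟩

theorem weakEnergy_nonneg (u : ℝ → ℝ) : 0 ≤ weakEnergy u := by
  obtain ⟨h, hh⟩ := exists_energyDual_eq_zero u
  by_cases hb : BddAbove (range (energyDual u))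
  · exact hh ▸ le_ciSup hb h
  · exact (Real.sSup_of_not_bddAbove hb).ge

theorem energyDual_congr {u v : ℝ → ℝ} (huv : EqOn u v (Icc 0 1)) :
    energyDual u = energyDual v := by
  ext h
  have hr : h.right ∈ Icc (0 : ℝ) 1 := ⟨h.left_nonneg.trans h.left_le_right, h.right_le_one⟩
  have hl : h.left ∈ Icc (0 : ℝ) 1 := ⟨h.left_nonneg, h.left_le_right.trans h.right_le_one⟩
  have e : ∫ x in (0 : ℝ)..1, u x * deriv h.toFun x = ∫ x in (0 : ℝ)..1, v x * deriv h.toFun x :=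
    intervalIntegral.integral_congr fun x hx => by
      rw [uIcc_of_le zero_le_one] at hx
      simp only [huv hx]
  simp only [energyDual, e, huv hr, huv hl]

theorem weakEnergy_add_mul_le {u φ φ' φ'' : ℝ → ℝ} (hu : Continuous u)
    (hb : BddAbove (range (energyDual u)))
    (hφ : ∀ x, HasDerivAt φ (φ' x) x) (hφ' : ∀ x, HasDerivAt φ' (φ'' x) x)
    (hφ'' : Continuous φ'') (h0 : φ 0 = 0) (h1 : φ 1 = 0) (x : ℝ) :
    ∀ h, energyDual (fun t => u t + x * φ t) h ≤ weakEnergy u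
      - 2 * x * (∫ t in (0 : ℝ)..1, u t * φ'' t) + x ^ 2 * ∫ t in (0 : ℝ)..1, φ' t ^ 2 := by
  intro h
  obtain ⟨h', hh'⟩ := exists_energyDual_add_mul hu hφ hφ' hφ'' h0 h1 x h
  have : energyDual u h' ≤ weakEnergy u := le_ciSup hb h'
  linarith

theorem weakEnergy_eq_integral_sq {u u' u'' : ℝ → ℝ} (hu : ∀ x, HasDerivAt u (u' x) x)
    (hu' : ∀ x, HasDerivAt u' (u'' x) x) (hu'' : Continuous u'') (h0 : u 0 = 0) (h1 : u 1 = 0) :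
    weakEnergy u = ∫ x in (0 : ℝ)..1, u' x ^ 2 := by
  have huc : Continuous u := continuous_iff_continuousAt.2 fun y => (hu y).continuousAt
  have hu'c : Continuous u' := continuous_iff_continuousAt.2 fun y => (hu' y).continuousAt
  have hdu' : deriv u' = u'' := funext fun y => (hu' y).deriv
  have hC1 : ContDiff ℝ 1 u' := contDiff_one_iff_deriv.2
    ⟨fun y => (hu' y).differentiableAt, by rwa [hdu']⟩
  have hle : ∀ h, energyDual u h ≤ ∫ x in (0 : ℝ)..1, u' x ^ 2 :=
    energyDual_le_integral_sq huc.continuousOn (fun x _ => (hu x).hasDerivWithinAt)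
      (hu'c.intervalIntegrable _ _) ((hu'c.pow 2).intervalIntegrable _ _) h0 h1
  obtain ⟨h₀, -⟩ := exists_energyDual_eq_zero u
  have : Nonempty EnergyTest := ⟨h₀⟩
  refine le_antisymm (ciSup_le hle) ?_
  have h := le_ciSup (f := energyDual u) ⟨_, forall_mem_range.2 hle⟩
    ⟨u', 0, 0, 0, hC1, le_rfl, le_rfl, zero_le_one⟩
  have e : ∫ x in (0 : ℝ)..1, u x * u'' x = - ∫ x in (0 : ℝ)..1, u' x * u' x := by
    rw [intervalIntegral.integral_mul_deriv_eq_deriv_mul (fun y _ => hu y) (fun y _ => hu' y)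
      (hu'c.intervalIntegrable _ _) (hu''.intervalIntegrable _ _), h0, h1]
    ring
  simp only [energyDual, hdu', e, ← sq] at h
  simp only [weakEnergy]
  linarith

/-! ### The two-point boundary value problem -/

theorem exists_boundary_value_solution {g : ℝ → ℝ} (hg : Continuous g) :
    ∃ G G' : ℝ → ℝ, (∀ x, HasDerivAt G (G' x) x) ∧ (∀ x, HasDerivAt G' (g x) x) ∧
      G 0 = 0 ∧ G 1 = 0 := by
  set p : ℝ → ℝ := fun x => ∫ s in (0 : ℝ)..x, g s with hp
  have hpd : ∀ x, HasDerivAt p (g x) x := fun x => hg.integral_hasStrictDerivAt 0 x |>.hasDerivAt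
  have hpc : Continuous p := continuous_iff_continuousAt.2 fun y => (hpd y).continuousAt
  set q : ℝ → ℝ := fun x => ∫ s in (0 : ℝ)..x, p s with hq
  have hqd : ∀ x, HasDerivAt q (p x) x := fun x => hpc.integral_hasStrictDerivAt 0 x |>.hasDerivAt
  refine ⟨fun x => q x - q 1 * x, fun x => p x - q 1, fun x => ?_, fun x => ?_, ?_, ?_⟩
  · have := (hqd x).sub ((hasDerivAt_id x).const_mul (q 1))
    rwa [mul_one] at this
  · exact (hpd x).sub_const _
  · simp [hq]
  · simp

theorem eq_zero_of_integral_eq_zero_of_nonneg {w : ℝ → ℝ} (hw : Continuous w) (h0 : ∀ x, 0 ≤ w x)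
    (h : ∫ x in (0 : ℝ)..1, w x = 0) : ∀ x ∈ Icc (0 : ℝ) 1, w x = 0 := by
  by_contra! hne
  obtain ⟨x, hx, hwx⟩ := hne
  exact (intervalIntegral.integral_pos zero_lt_one hw.continuousOn (fun y _ => h0 y)
    ⟨x, hx, (h0 x).lt_of_ne' hwx⟩).ne' h

/-! ### The space of functions of energy less than `ρ` -/

/-- The constant extension to `ℝ` of a function on `[0,1]`. -/
noncomputable def extendLine (u : C(unitInterval, ℝ)) : ℝ → ℝ := IccExtend zero_le_one u

theorem continuous_extendLine (u : C(unitInterval, ℝ)) : Continuous (extendLine u) :=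
  u.continuous.Icc_extend'

theorem extendLine_coe (u : C(unitInterval, ℝ)) (t : unitInterval) : extendLine u t = u t :=
  IccExtend_val _ _ t

theorem extendLine_zero (u : C(unitInterval, ℝ)) : extendLine u 0 = u 0 := extendLine_coe u 0

theorem extendLine_one (u : C(unitInterval, ℝ)) : extendLine u 1 = u 1 := extendLine_coe u 1

theorem integral_unitInterval_eq (g : unitInterval → ℝ) (G : ℝ → ℝ)
    (h : ∀ t : unitInterval, G t = g t) :
    ∫ t : unitInterval, g t = ∫ t in (0 : ℝ)..1, G t := by
  rw [intervalIntegral.integral_of_le zero_le_one, ← integral_Icc_eq_integral_Ioc,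
    ← unitInterval.measurePreserving_coe.integral_comp unitInterval.measurableEmbedding_coe]
  simp only [h]

theorem continuous_energyDual_extendLine (h : EnergyTest) :
    Continuous fun u : C(unitInterval, ℝ) => energyDual (extendLine u) h := by
  have hdk : Continuous (deriv h.toFun) := h.contDiff.continuous_deriv le_rfl
  have hev : Continuous fun p : C(unitInterval, ℝ) × ℝ => extendLine p.1 p.2 :=
    continuous_fst.eval (continuous_projIcc.comp continuous_snd)
  have hpt : ∀ t : ℝ, Continuous fun u : C(unitInterval, ℝ) => extendLine u t := fun t =>
    hev.comp (continuous_id.prodMk continuous_const)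
  have hint : Continuous fun u : C(unitInterval, ℝ) =>
      ∫ x in (0 : ℝ)..1, extendLine u x * deriv h.toFun x :=
    intervalIntegral.continuous_parametric_intervalIntegral_of_continuous'
      (f := fun (u : C(unitInterval, ℝ)) x => extendLine u x * deriv h.toFun x)
      (hev.mul (hdk.comp continuous_snd)) 0 1
  simp only [energyDual]
  have h1 := hpt h.left
  have h2 := hpt h.right
  fun_prop

/-- Functions of bounded energy are uniformly Hölder continuous of exponent `1/2`. -/
theorem isCompact_energyDual_le (r : ℝ) : IsCompact {u : C(unitInterval, ℝ) |
    u 0 = 0 ∧ u 1 = 0 ∧ ∀ h, energyDual (extendLine u) h ≤ r} := by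
  have hholder : ∀ u : C(unitInterval, ℝ), (∀ h, energyDual (extendLine u) h ≤ r) →
      ∀ s t : unitInterval, (u t - u s) ^ 2 ≤ r * |(t : ℝ) - s| := by
    intro u hu s t
    rcases le_total s t with hst | hst
    · have := sq_sub_le_of_energyDual_le hu s.2.1 hst t.2.2
      rwa [extendLine_coe, extendLine_coe,
        ← abs_of_nonneg (sub_nonneg.2 (show (s : ℝ) ≤ t from hst))] at this
    · have := sq_sub_le_of_energyDual_le hu t.2.1 hst s.2.2
      rw [extendLine_coe, extendLine_coe,
        ← abs_of_nonneg (sub_nonneg.2 (show (t : ℝ) ≤ s from hst)), abs_sub_comm] at this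
      nlinarith
  let e := ContinuousMap.isometryEquivBoundedOfCompact unitInterval ℝ
  rw [← e.toHomeomorph.isCompact_image]
  set A := {u : C(unitInterval, ℝ) |
    u 0 = 0 ∧ u 1 = 0 ∧ ∀ h, energyDual (extendLine u) h ≤ r} with hA
  have hAclosed : IsClosed A := by
    refine IsClosed.inter (isClosed_eq (continuous_eval_const _) continuous_const)
      (IsClosed.inter (isClosed_eq (continuous_eval_const _) continuous_const) ?_)
    change IsClosed {u : C(unitInterval, ℝ) | ∀ h, energyDual (extendLine u) h ≤ r}
    rw [show {u : C(unitInterval, ℝ) | ∀ h, energyDual (extendLine u) h ≤ r} =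
      ⋂ h, {u | energyDual (extendLine u) h ≤ r} by ext; simp]
    exact isClosed_iInter fun h => isClosed_le (continuous_energyDual_extendLine h) continuous_const
  refine BoundedContinuousFunction.arzela_ascoli₂ (Icc (-(r + 1)) (r + 1)) isCompact_Icc _
    (e.toHomeomorph.isClosedMap _ hAclosed) ?_ ?_
  · rintro _ x ⟨u, ⟨hu0, -, hu⟩, rfl⟩
    have h1 := hholder u hu 0 x
    have hx := x.2
    have h2 : |(x : ℝ) - (0 : unitInterval)| ≤ 1 := by
      rw [abs_of_nonneg] <;> simp [hx.1, hx.2]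
    rw [hu0, sub_zero] at h1
    have hr : 0 ≤ r := by
      obtain ⟨h, hh⟩ := exists_energyDual_eq_zero (extendLine u)
      exact hh ▸ hu h
    have h3 : u x ^ 2 ≤ r := h1.trans (by nlinarith)
    exact abs_le.1 (abs_le_of_sq_le_sq (h3.trans (by nlinarith)) (by linarith))
  · have hlim : Tendsto (fun d : ℝ => √(r * d)) (𝓝 0) (𝓝 0) := by
      have : Continuous fun d : ℝ => √(r * d) := by fun_prop
      simpa using this.tendsto 0
    refine Metric.equicontinuous_of_continuity_modulus _ hlim _ ?_
    rintro x y ⟨_, u, ⟨-, -, hu⟩, rfl⟩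
    rw [dist_comm, Real.dist_eq, dist_comm]
    exact Real.abs_le_sqrt (hholder u hu x y)

/-- Continuous functions on `[0,1]` that vanish at the endpoints and have finite Dirichlet energy,
less than `ρ`; it carries the topology of uniform convergence. -/
abbrev EnergyBall (ρ : ℝ) : Type :=
  {u : C(unitInterval, ℝ) // u 0 = 0 ∧ u 1 = 0 ∧ BddAbove (range (energyDual (extendLine u))) ∧
    weakEnergy (extendLine u) < ρ}

namespace EnergyBall

variable {ρ : ℝ}

/-- The Dirichlet energy of an element of the energy ball. -/
noncomputable def energy (u : EnergyBall ρ) : ℝ := weakEnergy (extendLine u.1)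

theorem energy_lt (u : EnergyBall ρ) : u.energy < ρ := u.2.2.2.2

theorem energy_nonneg (u : EnergyBall ρ) : 0 ≤ u.energy := weakEnergy_nonneg _

theorem energyDual_le (u : EnergyBall ρ) (h : EnergyTest) :
    energyDual (extendLine u.1) h ≤ u.energy := le_ciSup u.2.2.2.1 h

theorem sq_apply_le (u : EnergyBall ρ) (t : unitInterval) : u.1 t ^ 2 ≤ u.energy / 4 := by
  rw [← extendLine_coe]
  exact sq_le_of_energyDual_le u.energyDual_le (by rw [extendLine_zero, u.2.1]) t.2

theorem lowerSemicontinuous_energy : LowerSemicontinuous (energy (ρ := ρ)) :=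
  lowerSemicontinuous_ciSup (fun u => u.2.2.2.1) fun h =>
    ((continuous_energyDual_extendLine h).comp continuous_subtype_val).lowerSemicontinuous

theorem isCompact_energy_le {r : ℝ} (hr : r < ρ) : IsCompact {u : EnergyBall ρ | u.energy ≤ r} := by
  rw [Subtype.isCompact_iff]
  convert isCompact_energyDual_le r using 1
  ext u
  constructor
  · rintro ⟨u, hu, rfl⟩
    exact ⟨u.2.1, u.2.2.1, fun h => (energyDual_le u h).trans hu⟩
  · rintro ⟨h0, h1, hu⟩
    have hne : Nonempty EnergyTest := ⟨(exists_energyDual_eq_zero 0).choose⟩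
    have hle : weakEnergy (extendLine u) ≤ r := ciSup_le hu
    exact ⟨⟨u, h0, h1, ⟨r, forall_mem_range.2 hu⟩, hle.trans_lt hr⟩, hle, rfl⟩

theorem exists_of_energyDual_le {u : ℝ → ℝ} (hu : Continuous u) (h0 : u 0 = 0) (h1 : u 1 = 0)
    {r : ℝ} (hr : ∀ h, energyDual u h ≤ r) (hrρ : r < ρ) :
    ∃ v : EnergyBall ρ, v.energy ≤ r ∧ ∀ t : unitInterval, v.1 t = u t := by
  let v : C(unitInterval, ℝ) := ⟨fun t => u t, by fun_prop⟩
  have hv : energyDual (extendLine v) = energyDual u :=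
    energyDual_congr fun t ht => extendLine_coe v ⟨t, ht⟩
  have hne : Nonempty EnergyTest := ⟨(exists_energyDual_eq_zero 0).choose⟩
  have hle : weakEnergy (extendLine v) ≤ r := by
    rw [weakEnergy, hv]
    exact ciSup_le hr
  exact ⟨⟨v, h0, h1, ⟨r, by rw [hv]; exact forall_mem_range.2 hr⟩, hle.trans_lt hrρ⟩, hle,
    fun t => rfl⟩

/-- The tent function with value `x` at `1/2` has energy at most `4 x²`. -/
theorem exists_apply_half_eq {x : ℝ} (hx : 4 * x ^ 2 < ρ) :
    ∃ u : EnergyBall ρ, u.1 ⟨1 / 2, by norm_num, by norm_num⟩ = x := by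
  set u : ℝ → ℝ := fun t => x - 2 * x * |t - 1 / 2| with hu
  set v : ℝ → ℝ := fun t => if t < 1 / 2 then 2 * x else -(2 * x) with hv
  have huc : Continuous u := by fun_prop
  have hv2 : (fun t => v t ^ 2) = fun _ => 4 * x ^ 2 := by
    ext t
    simp only [hv]
    split_ifs <;> ring
  have hvm : Measurable v := Measurable.ite measurableSet_Iio measurable_const measurable_const
  have hvi : IntervalIntegrable v volume 0 1 := by
    refine (intervalIntegrable_const (c := |2 * x|)).mono_fun hvm.aestronglyMeasurable
      (ae_of_all _ fun t => ?_)
    simp only [hv]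
    split_ifs <;> simp
  have hder : ∀ t ∈ Ioo (0 : ℝ) 1, HasDerivWithinAt u (v t) (Ioi t) t := by
    intro t _
    by_cases ht : t < 1 / 2
    · have h1 : HasDerivAt (fun t => x - 2 * x * (1 / 2 - t)) (2 * x) t := by
        have := (((hasDerivAt_id t).const_sub (1 / 2)).const_mul (2 * x)).const_sub x
        simpa using this
      have h2 : u =ᶠ[𝓝 t] fun t => x - 2 * x * (1 / 2 - t) := by
        filter_upwards [gt_mem_nhds ht] with s hs
        simp only [hu]
        rw [abs_of_neg (by linarith)]
        ring
      simp only [hv, if_pos ht]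
      exact (h1.congr_of_eventuallyEq h2).hasDerivWithinAt
    · have h1 : HasDerivAt (fun t => x - 2 * x * (t - 1 / 2)) (-(2 * x)) t := by
        have := (((hasDerivAt_id t).sub_const (1 / 2)).const_mul (2 * x)).const_sub x
        simpa using this
      have h2 : ∀ s ∈ Ici t, u s = x - 2 * x * (s - 1 / 2) := by
        intro s hs
        simp only [hu]
        rw [abs_of_nonneg (by linarith [mem_Ici.1 hs])]
      simp only [hv, if_neg ht]
      exact h1.hasDerivWithinAt.congr (fun s hs => h2 s (Ioi_subset_Ici_self hs))
        (h2 t self_mem_Ici)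
  have h0 : u 0 = 0 := by
    simp only [hu]
    rw [abs_of_neg (by norm_num)]
    ring
  have h1 : u 1 = 0 := by
    simp only [hu]
    rw [abs_of_pos (by norm_num)]
    ring
  have hle : ∀ h, energyDual u h ≤ 4 * x ^ 2 := fun h => by
    have := energyDual_le_integral_sq huc.continuousOn hder hvi
      (by rw [hv2]; exact intervalIntegrable_const) h0 h1 h
    simpa [hv2] using this
  obtain ⟨w, -, hw⟩ := exists_of_energyDual_le huc h0 h1 hle hx
  exact ⟨w, by rw [hw]; simp [hu]⟩

end EnergyBall

/-! ### The potential of the Kirchhoff term -/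

/-- The primitive of `ω` vanishing at `0`, with `ω` extended to the left of `0` by the constant
`ω 0` so that the primitive is differentiable at `0` as well. -/
noncomputable def kirchhoffPotential (ω : ℝ → ℝ) (x : ℝ) : ℝ := ∫ s in (0 : ℝ)..x, ω (max s 0)

section Potential

variable {ω : ℝ → ℝ} {ρ : ℝ}

theorem continuousOn_comp_max (hρ : 0 < ρ) (hω : ContinuousOn ω (Ico 0 ρ)) :
    ContinuousOn (fun s => ω (max s 0)) (Iio ρ) :=
  hω.comp (by fun_prop) fun _ hs => ⟨le_max_right _ _, max_lt hs hρ⟩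

theorem intervalIntegrable_comp_max (hρ : 0 < ρ) (hω : ContinuousOn ω (Ico 0 ρ)) {a b : ℝ}
    (ha : a < ρ) (hb : b < ρ) : IntervalIntegrable (fun s => ω (max s 0)) volume a b :=
  ((continuousOn_comp_max hρ hω).mono fun _ hs => hs.2.trans_lt (max_lt ha hb)).intervalIntegrable

theorem hasDerivAt_kirchhoffPotential (hρ : 0 < ρ) (hω : ContinuousOn ω (Ico 0 ρ)) {x : ℝ}
    (hx : x < ρ) : HasDerivAt (kirchhoffPotential ω) (ω (max x 0)) x :=
  intervalIntegral.integral_hasDerivAt_right (intervalIntegrable_comp_max hρ hω hρ hx)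
    ((continuousOn_comp_max hρ hω).stronglyMeasurableAtFilter isOpen_Iio x hx)
    ((continuousOn_comp_max hρ hω).continuousAt (Iio_mem_nhds hx))

theorem kirchhoffPotential_mono (hρ : 0 < ρ) (hω : ContinuousOn ω (Ico 0 ρ))
    (hω0 : ∀ x ∈ Ico 0 ρ, 0 ≤ ω x) {x y : ℝ} (hxy : x ≤ y) (hy : y < ρ) :
    kirchhoffPotential ω x ≤ kirchhoffPotential ω y := by
  have h := intervalIntegral.integral_interval_sub_left
    (intervalIntegrable_comp_max hρ hω hρ hy) (intervalIntegrable_comp_max hρ hω hρ (hxy.trans_lt hy))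
  have h2 : 0 ≤ ∫ s in x..y, ω (max s 0) := intervalIntegral.integral_nonneg hxy fun s hs =>
    hω0 _ ⟨le_max_right _ _, max_lt (hs.2.trans_lt hy) hρ⟩
  simp only [kirchhoffPotential]
  linarith

theorem exists_lt_kirchhoffPotential (hρ : 0 < ρ)
    (hlim : Tendsto (fun ξ : ℝ => ∫ x in (0 : ℝ)..ξ, ω x) (𝓝[<] ρ) atTop) (a : ℝ) :
    ∃ r, 0 ≤ r ∧ r < ρ ∧ a < kirchhoffPotential ω r := by
  obtain ⟨r, hr, hr0, hrρ⟩ := ((hlim.eventually (eventually_gt_atTop a)).and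
    (Ioo_mem_nhdsLT hρ)).exists
  refine ⟨r, hr0.le, hrρ, hr.trans_eq (intervalIntegral.integral_congr fun s hs => ?_)⟩
  rw [uIcc_of_le hr0.le] at hs
  simp only [max_eq_left hs.1]

end Potential

/-! ### The load term -/

theorem integrable_of_continuous_unitInterval {g : unitInterval → ℝ} (hg : Continuous g) :
    Integrable g :=
  hg.integrable_of_hasCompactSupport (HasCompactSupport.of_compactSpace _)

/-- The functional `(α, β) ↦ ∫₀¹ α p + ∫₀¹ β q`. -/
noncomputable def loadPairing (p q : C(unitInterval, ℝ)) :
    C(unitInterval, ℝ) × C(unitInterval, ℝ) →ₗ[ℝ] ℝ where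
  toFun y := ∫ t : unitInterval, (y.1 t * p t + y.2 t * q t)
  map_add' y z := by
    rw [← integral_add (integrable_of_continuous_unitInterval (by fun_prop))
      (integrable_of_continuous_unitInterval (by fun_prop))]
    congr 1
    ext t
    simp only [Prod.fst_add, Prod.snd_add, ContinuousMap.add_apply]
    ring
  map_smul' c y := by
    rw [RingHom.id_apply, smul_eq_mul, ← integral_const_mul]
    congr 1
    ext t
    simp only [Prod.smul_fst, Prod.smul_snd, ContinuousMap.smul_apply, smul_eq_mul]
    ring

theorem loadPairing_apply (p q : C(unitInterval, ℝ))
    (y : C(unitInterval, ℝ) × C(unitInterval, ℝ)) :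
    loadPairing p q y = ∫ t : unitInterval, (y.1 t * p t + y.2 t * q t) := rfl

theorem abs_loadPairing_le {p q : C(unitInterval, ℝ)} {M : ℝ} (hp : ∀ t, |p t| ≤ M)
    (hq : ∀ t, |q t| ≤ M) (y : C(unitInterval, ℝ) × C(unitInterval, ℝ)) :
    |loadPairing p q y| ≤ M * l1Norm y := by
  have h1 : Integrable fun t : unitInterval => |y.1 t| :=
    integrable_of_continuous_unitInterval (by fun_prop)
  have h2 : Integrable fun t : unitInterval => |y.2 t| :=
    integrable_of_continuous_unitInterval (by fun_prop)
  rw [l1Norm, ← integral_add h1 h2, ← integral_const_mul]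
  refine (abs_integral_le_integral_abs).trans (integral_mono
    (integrable_of_continuous_unitInterval (by fun_prop)) ((h1.add h2).const_mul M) fun t => ?_)
  refine (abs_add_le _ _).trans ?_
  simp only [abs_mul, mul_add]
  nlinarith [hp t, hq t, abs_nonneg (y.1 t), abs_nonneg (y.2 t)]

theorem continuous_loadPairing (y : C(unitInterval, ℝ) × C(unitInterval, ℝ)) :
    Continuous fun pq : C(unitInterval, ℝ) × C(unitInterval, ℝ) => loadPairing pq.1 pq.2 y := by
  have h : ∀ pq : C(unitInterval, ℝ) × C(unitInterval, ℝ), loadPairing pq.1 pq.2 y =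
      ∫ t in (0 : ℝ)..1, (y.1 (projIcc 0 1 zero_le_one t) * pq.1 (projIcc 0 1 zero_le_one t)
        + y.2 (projIcc 0 1 zero_le_one t) * pq.2 (projIcc 0 1 zero_le_one t)) := fun pq =>
    integral_unitInterval_eq _ _ fun t => by simp only [projIcc_val]
  simp only [h]
  refine intervalIntegral.continuous_parametric_intervalIntegral_of_continuous'
    (f := fun (pq : C(unitInterval, ℝ) × C(unitInterval, ℝ)) t =>
      y.1 (projIcc 0 1 zero_le_one t) * pq.1 (projIcc 0 1 zero_le_one t)
        + y.2 (projIcc 0 1 zero_le_one t) * pq.2 (projIcc 0 1 zero_le_one t)) ?_ 0 1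
  have hproj : Continuous fun z : (C(unitInterval, ℝ) × C(unitInterval, ℝ)) × ℝ =>
    projIcc (0 : ℝ) 1 zero_le_one z.2 := continuous_projIcc.comp continuous_snd
  simp only [Function.uncurry_def]
  fun_prop

/-- A pair `(p, q)` of continuous functions at which the pairing is bounded below on a set dense for
`l1Norm` vanishes, since a linear functional bounded below is zero. -/
theorem eq_zero_of_bddBelow_loadPairing {S : Set (C(unitInterval, ℝ) × C(unitInterval, ℝ))}
    (hS : L1Dense S) {p q : C(unitInterval, ℝ)} {C : ℝ} (hC : ∀ y ∈ S, C ≤ loadPairing p q y) :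
    p = 0 ∧ q = 0 := by
  set M := ‖p‖ + ‖q‖ + 1 with hM
  have hMpos : 0 < M := by positivity
  have hp : ∀ t, |p t| ≤ M := fun t => by
    linarith [p.norm_coe_le_norm t, Real.norm_eq_abs (p t), norm_nonneg q]
  have hq : ∀ t, |q t| ≤ M := fun t => by
    linarith [q.norm_coe_le_norm t, Real.norm_eq_abs (q t), norm_nonneg p]
  have hall : ∀ y, C - 1 ≤ loadPairing p q y := by
    intro y
    obtain ⟨z, hz, hyz⟩ := hS y (1 / M) (by positivity)
    have h1 := abs_loadPairing_le hp hq (y - z)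
    have h2 : M * l1Norm (y - z) ≤ 1 := by
      calc M * l1Norm (y - z) ≤ M * (1 / M) := by gcongr
        _ = 1 := by field_simp
    rw [map_sub] at h1
    linarith [(abs_le.1 h1).1, hC z hz]
  have hzero : loadPairing p q (p, q) = 0 := by
    by_contra hne
    have := hall (((C - 2) / loadPairing p q (p, q)) • (p, q))
    rw [map_smul, smul_eq_mul, div_mul_cancel₀ _ hne] at this
    linarith
  rw [loadPairing_apply] at hzero
  rw [integral_unitInterval_eq _ (fun t => extendLine p t * extendLine p t +
    extendLine q t * extendLine q t) fun t => by simp only [extendLine_coe]] at hzero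
  have hp := continuous_extendLine p
  have hq := continuous_extendLine q
  have hfun := eq_zero_of_integral_eq_zero_of_nonneg (by fun_prop)
    (fun t => add_nonneg (mul_self_nonneg _) (mul_self_nonneg _)) hzero
  constructor <;> ext t <;> have := hfun t t.2 <;>
    simp only [extendLine_coe, ContinuousMap.zero_apply] at this ⊢ <;>
    nlinarith [mul_self_nonneg (p t), mul_self_nonneg (q t)]

/-! ### Minimizers of the energy functional -/

section Functional

variable {f ω : ℝ → ℝ} {ρ : ℝ}

theorem lowerSemicontinuous_kirchhoffPotential_energy (hρ : 0 < ρ) (hω : ContinuousOn ω (Ico 0 ρ))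
    (hω0 : ∀ x ∈ Ico 0 ρ, 0 ≤ ω x) :
    LowerSemicontinuous fun u : EnergyBall ρ => kirchhoffPotential ω u.energy := by
  intro u y hy
  have hc := (hasDerivAt_kirchhoffPotential hρ hω u.energy_lt).continuousAt
  have hev : ∀ᶠ e in 𝓝[<] u.energy, y < kirchhoffPotential ω e ∧ e < u.energy :=
    ((hc.eventually (lt_mem_nhds hy)).filter_mono nhdsWithin_le_nhds).and self_mem_nhdsWithin
  obtain ⟨e, hye, he⟩ := hev.exists
  filter_upwards [EnergyBall.lowerSemicontinuous_energy u e he] with v hv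
  exact hye.trans_le (kirchhoffPotential_mono hρ hω hω0 hv.le v.energy_lt)

/-- The potential dominates the load term, which is bounded on the energy ball, so the sublevel sets
of the functional stay at positive distance from the boundary of the ball. -/
theorem isCompact_functional_le (hρ : 0 < ρ) (hω : ContinuousOn ω (Ico 0 ρ))
    (hω0 : ∀ x ∈ Ico 0 ρ, 0 ≤ ω x)
    (hlim : Tendsto (fun ξ : ℝ => ∫ x in (0 : ℝ)..ξ, ω x) (𝓝[<] ρ) atTop)
    (F : C(ℝ, ℝ)) (a b : C(unitInterval, ℝ)) (y : C(unitInterval, ℝ) × C(unitInterval, ℝ))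
    (r : ℝ) :
    IsCompact {u : EnergyBall ρ | kirchhoffPotential ω u.energy / 2 +
      (-loadPairing (u.1 - a) (F.comp u.1 - b)) y ≤ r} := by
  obtain ⟨K, hK⟩ := (isCompact_Icc (a := -(ρ + 1)) (b := ρ + 1)).exists_bound_of_continuousOn
    F.continuous.continuousOn
  have hK0 : 0 ≤ K := (norm_nonneg _).trans (hK 0 ⟨by linarith, by linarith⟩)
  set M := ρ + 1 + K + ‖a‖ + ‖b‖ with hM
  have hbound : ∀ u : EnergyBall ρ, |loadPairing (u.1 - a) (F.comp u.1 - b) y| ≤ M * l1Norm y := by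
    intro u
    have hu : ∀ t, |u.1 t| ≤ ρ + 1 := fun t => by
      have h1 := u.sq_apply_le t
      have h2 := u.energy_lt
      have h3 := u.energy_nonneg
      exact abs_le_of_sq_le_sq (by nlinarith) (by linarith)
    refine abs_loadPairing_le (fun t => ?_) (fun t => ?_) y
    · have h1 := abs_sub (u.1 t) (a t)
      have h2 := a.norm_coe_le_norm t
      rw [Real.norm_eq_abs] at h2
      rw [ContinuousMap.sub_apply]
      linarith [hu t, norm_nonneg b]
    · have h1 := abs_sub (F (u.1 t)) (b t)
      have h2 := b.norm_coe_le_norm t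
      have h3 := hK (u.1 t) (abs_le.1 (hu t))
      rw [Real.norm_eq_abs] at h2 h3
      rw [ContinuousMap.sub_apply, ContinuousMap.comp_apply]
      linarith [norm_nonneg a]
  obtain ⟨s, -, hsρ, hs⟩ := exists_lt_kirchhoffPotential hρ hlim (2 * (r + M * l1Norm y))
  refine (EnergyBall.isCompact_energy_le hsρ).of_isClosed_subset ?_ fun u hu => ?_
  · have hcont : Continuous fun u : EnergyBall ρ =>
        (-loadPairing (u.1 - a) (F.comp u.1 - b)) y := by
      have := (continuous_loadPairing y).comp
        (f := fun u : EnergyBall ρ => (u.1 - a, F.comp u.1 - b))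
        (((continuous_subtype_val.sub continuous_const)).prodMk
          (((ContinuousMap.continuous_postcomp F).comp continuous_subtype_val).sub
            continuous_const))
      simp only [LinearMap.neg_apply]
      exact this.neg
    have hhalf : LowerSemicontinuous fun u : EnergyBall ρ => kirchhoffPotential ω u.energy / 2 :=
      Continuous.comp_lowerSemicontinuous (g := fun x : ℝ => x / 2) (by fun_prop)
        (lowerSemicontinuous_kirchhoffPotential_energy hρ hω hω0)
        (fun x y hxy => by dsimp only; linarith)
    exact (hhalf.add hcont.lowerSemicontinuous).isClosed_preimage r
  · by_contra hlt
    have h1 := kirchhoffPotential_mono hρ hω hω0 (not_le.1 hlt).le u.energy_lt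
    have h2 := (abs_le.1 (hbound u)).2
    simp only [mem_ofPred_eq, LinearMap.neg_apply] at hu
    linarith

/-- The Euler–Lagrange equation of a minimizer, integrated twice by parts. -/
theorem euler_lagrange_of_isMin (hf : Continuous f) (hρ : 0 < ρ) (hω : ContinuousOn ω (Ico 0 ρ))
    (hω0 : ∀ x ∈ Ico 0 ρ, 0 ≤ ω x) {F : C(ℝ, ℝ)} (hF : ∀ x, HasDerivAt F (f x) x)
    {y : C(unitInterval, ℝ) × C(unitInterval, ℝ)} {u : EnergyBall ρ}
    (hu : ∀ z : EnergyBall ρ, kirchhoffPotential ω u.energy / 2 - loadPairing u.1 (F.comp u.1) y ≤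
      kirchhoffPotential ω z.energy / 2 - loadPairing z.1 (F.comp z.1) y)
    {φ φ' φ'' : ℝ → ℝ} (hφ : ∀ x, HasDerivAt φ (φ' x) x) (hφ' : ∀ x, HasDerivAt φ' (φ'' x) x)
    (hφ'' : Continuous φ'') (h0 : φ 0 = 0) (h1 : φ 1 = 0) :
    ω u.energy * (∫ t in (0 : ℝ)..1, extendLine u.1 t * φ'' t) +
      ∫ t in (0 : ℝ)..1, (extendLine y.1 t + extendLine y.2 t * f (extendLine u.1 t)) * φ t = 0 := by
  have hφc : Continuous φ := continuous_iff_continuousAt.2 fun y => (hφ y).continuousAt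
  set U := extendLine u.1 with hU
  set A := extendLine y.1 with hA
  set B := extendLine y.2 with hB
  have hUc : Continuous U := continuous_extendLine _
  have hAc : Continuous A := continuous_extendLine _
  have hBc : Continuous B := continuous_extendLine _
  have hFc := F.continuous
  set a := ∫ t in (0 : ℝ)..1, U t * φ'' t with ha
  set b := ∫ t in (0 : ℝ)..1, φ' t ^ 2 with hb
  set e : ℝ → ℝ := fun x => u.energy - 2 * x * a + x ^ 2 * b with he
  set P : ℝ → ℝ := fun x => ∫ t in (0 : ℝ)..1, (A t * (U t + x * φ t) + B t * F (U t + x * φ t))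
    with hP
  have hPz : ∀ x, ∀ z : EnergyBall ρ, (∀ t : unitInterval, z.1 t = U t + x * φ t) →
      loadPairing z.1 (F.comp z.1) y = P x := fun x z hz =>
    integral_unitInterval_eq _ _ fun t => by
      simp only [ContinuousMap.comp_apply, hz, hA, hB, extendLine_coe]
  have he0 : e 0 = u.energy := by simp [he]
  have hmin : IsLocalMin (fun x => kirchhoffPotential ω (e x) / 2 - P x) 0 := by
    have hec : Continuous e := by fun_prop
    have hlt : ∀ᶠ x in 𝓝 (0 : ℝ), e x < ρ :=
      hec.continuousAt.eventually (gt_mem_nhds (by rw [he0]; exact u.energy_lt))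
    filter_upwards [hlt] with x hx
    obtain ⟨z, hzE, hz⟩ := EnergyBall.exists_of_energyDual_le (u := fun t => U t + x * φ t)
      (by fun_prop) (by simp [hU, extendLine_zero, u.2.1, h0])
      (by simp [hU, extendLine_one, u.2.2.1, h1])
      (weakEnergy_add_mul_le hUc u.2.2.2.1 hφ hφ' hφ'' h0 h1 x) hx
    have h2 := hu z
    rw [hPz x z hz, hPz 0 u fun t => by simp [hU, extendLine_coe]] at h2
    rw [he0]
    have h3 := kirchhoffPotential_mono hρ hω hω0 hzE hx
    change _ ≤ kirchhoffPotential ω (e x) at h3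
    linarith
  have hed : HasDerivAt e (-2 * a) 0 := by
    have h1 := (((hasDerivAt_id (0 : ℝ)).const_mul 2).mul_const a).const_sub u.energy
    have h2 := ((hasDerivAt_id (0 : ℝ)).pow 2).mul_const b
    exact (show HasDerivAt e _ 0 from h1.add h2).congr_deriv (by simp)
  have hWd : HasDerivAt (fun x => kirchhoffPotential ω (e x)) (ω u.energy * (-2 * a)) 0 := by
    have h1 := hasDerivAt_kirchhoffPotential hρ hω u.energy_lt
    rw [max_eq_left u.energy_nonneg, ← he0] at h1
    have h2 := h1.comp (0 : ℝ) hed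
    rwa [he0] at h2
  have hPd : HasDerivAt P (∫ t in (0 : ℝ)..1, (A t + B t * f (U t)) * φ t) 0 := by
    obtain ⟨K, hK⟩ := ((isCompact_Icc (a := (-1 : ℝ)) (b := 1)).prod
      (isCompact_Icc (a := (0 : ℝ)) (b := 1))).exists_bound_of_continuousOn
      (f := fun p : ℝ × ℝ => (A p.2 + B p.2 * f (U p.2 + p.1 * φ p.2)) * φ p.2)
      (by fun_prop)
    have h := (intervalIntegral.hasDerivAt_integral_of_dominated_loc_of_deriv_le
      (μ := volume) (a := 0) (b := 1) (x₀ := (0 : ℝ)) (s := Icc (-1) 1) (bound := fun _ => K)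
      (F := fun x t => A t * (U t + x * φ t) + B t * F (U t + x * φ t))
      (F' := fun x t => (A t + B t * f (U t + x * φ t)) * φ t)
      (Icc_mem_nhds (by norm_num) (by norm_num))
      (Eventually.of_forall fun x => Continuous.aestronglyMeasurable (by fun_prop))
      (Continuous.intervalIntegrable (by fun_prop) _ _)
      (Continuous.aestronglyMeasurable (by fun_prop))
      (ae_of_all _ fun t ht x hx => hK (x, t) ⟨hx, by
        rw [uIoc_of_le zero_le_one] at ht
        exact Ioc_subset_Icc_self ht⟩)
      intervalIntegrable_const
      (ae_of_all _ fun t _ x _ => by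
        have h1 : HasDerivAt (fun x => U t + x * φ t) (φ t) x := by
          simpa using ((hasDerivAt_id x).mul_const (φ t)).const_add (U t)
        have h2 : HasDerivAt (fun x => A t * (U t + x * φ t) + B t * F (U t + x * φ t)) _ x :=
          (h1.const_mul (A t)).add (((hF _).comp x h1).const_mul (B t))
        exact h2.congr_deriv (by ring))).2
    simpa using h
  have h := hmin.hasDerivAt_eq_zero ((hWd.div_const 2).sub hPd)
  linarith

theorem derivWithin_Icc_eq {u u' : ℝ → ℝ} (hu : ∀ x, HasDerivAt u (u' x) x) {t : ℝ}
    (ht : t ∈ Icc (0 : ℝ) 1) : derivWithin u (Icc 0 1) t = u' t :=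
  (hu t).hasDerivWithinAt.derivWithin (uniqueDiffOn_Icc zero_lt_one t ht)

theorem iteratedDerivWithin_two_Icc_eq {u u' u'' : ℝ → ℝ} (hu : ∀ x, HasDerivAt u (u' x) x)
    (hu' : ∀ x, HasDerivAt u' (u'' x) x) {t : ℝ} (ht : t ∈ Icc (0 : ℝ) 1) :
    iteratedDerivWithin 2 u (Icc 0 1) t = u'' t := by
  rw [iteratedDerivWithin_succ, iteratedDerivWithin_one,
    derivWithin_congr (fun x hx => derivWithin_Icc_eq hu hx) (derivWithin_Icc_eq hu ht),
    derivWithin_Icc_eq hu' ht]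

theorem dirichletEnergy_eq {u u' : ℝ → ℝ} (hu : ∀ x, HasDerivAt u (u' x) x) :
    dirichletEnergy u = ∫ x in (0 : ℝ)..1, u' x ^ 2 :=
  intervalIntegral.integral_congr fun t ht => by
    rw [uIcc_of_le zero_le_one] at ht
    simp only [derivWithin_Icc_eq hu ht, sq_abs]

theorem contDiff_two_of_hasDerivAt {u u' u'' : ℝ → ℝ} (hu : ∀ x, HasDerivAt u (u' x) x)
    (hu' : ∀ x, HasDerivAt u' (u'' x) x) (hu'' : Continuous u'') : ContDiff ℝ 2 u := by
  have h1 : deriv u = u' := funext fun x => (hu x).deriv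
  have h2 : deriv u' = u'' := funext fun x => (hu' x).deriv
  rw [show (2 : WithTop ℕ∞) = 1 + 1 from one_add_one_eq_two.symm, contDiff_succ_iff_deriv]
  refine ⟨fun x => (hu x).differentiableAt, by simp, ?_⟩
  rw [h1, contDiff_one_iff_deriv, h2]
  exact ⟨fun x => (hu' x).differentiableAt, hu''⟩

/-- A global minimizer of the energy functional is a classical solution. -/
theorem exists_isKirchhoffSolution_of_isMin (hf : Continuous f) (hρ : 0 < ρ)
    (hω : ContinuousOn ω (Ico 0 ρ)) (hω0 : ∀ x ∈ Ico 0 ρ, 0 ≤ ω x)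
    (hωpos : ∀ x ∈ Ico 0 ρ, ω x = 0 → x = 0) {F : C(ℝ, ℝ)} (hF : ∀ x, HasDerivAt F (f x) x)
    {y : C(unitInterval, ℝ) × C(unitInterval, ℝ)} {u : EnergyBall ρ}
    (hu : ∀ z : EnergyBall ρ, kirchhoffPotential ω u.energy / 2 - loadPairing u.1 (F.comp u.1) y ≤
      kirchhoffPotential ω z.energy / 2 - loadPairing z.1 (F.comp z.1) y) :
    ∃ v, IsKirchhoffSolution f ω ρ y.1 y.2 v ∧ ∀ t : unitInterval, v t = u.1 t := by
  set U := extendLine u.1 with hU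
  have hUc : Continuous U := continuous_extendLine _
  set g : ℝ → ℝ := fun t => extendLine y.1 t + extendLine y.2 t * f (U t) with hg
  have hgc : Continuous g := by
    have := continuous_extendLine y.1
    have := continuous_extendLine y.2
    fun_prop
  have hgt : ∀ t : unitInterval, g t = y.1 t + y.2 t * f (u.1 t) := fun t => by
    simp only [hg, hU, extendLine_coe]
  -- `G` solves `-G'' = g`; the Euler–Lagrange equation says that `ω(E) u - G` is orthogonal to all
  -- continuous functions.
  obtain ⟨G, G', hG, hG', hG0, hG1⟩ := exists_boundary_value_solution (g := fun t => -g t) hgc.neg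
  have hGc : Continuous G := continuous_iff_continuousAt.2 fun y => (hG y).continuousAt
  have hG'c : Continuous G' := continuous_iff_continuousAt.2 fun y => (hG' y).continuousAt
  set w : ℝ → ℝ := fun t => ω u.energy * U t - G t with hw
  have hwc : Continuous w := by fun_prop
  obtain ⟨φ, φ', hφ, hφ', hφ0, hφ1⟩ := exists_boundary_value_solution hwc
  have hφc : Continuous φ := continuous_iff_continuousAt.2 fun y => (hφ y).continuousAt
  have hφ'c : Continuous φ' := continuous_iff_continuousAt.2 fun y => (hφ' y).continuousAt
  have hEL := euler_lagrange_of_isMin hf hρ hω hω0 hF hu hφ hφ' hwc hφ0 hφ1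
  have e1 : ∫ t in (0 : ℝ)..1, G t * w t = - ∫ t in (0 : ℝ)..1, G' t * φ' t := by
    rw [intervalIntegral.integral_mul_deriv_eq_deriv_mul (fun y _ => hG y) (fun y _ => hφ' y)
      (hG'c.intervalIntegrable _ _) (hwc.intervalIntegrable _ _), hG0, hG1]
    ring
  have e2 : ∫ t in (0 : ℝ)..1, G' t * φ' t = - ∫ t in (0 : ℝ)..1, -g t * φ t := by
    rw [intervalIntegral.integral_mul_deriv_eq_deriv_mul (fun y _ => hG' y) (fun y _ => hφ y)
      (hgc.neg.intervalIntegrable _ _) (hφ'c.intervalIntegrable _ _), hφ0, hφ1]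
    ring
  have e3 : ∫ t in (0 : ℝ)..1, -g t * φ t = - ∫ t in (0 : ℝ)..1, g t * φ t := by
    rw [← intervalIntegral.integral_neg]
    exact intervalIntegral.integral_congr fun t _ => by ring
  have e4 : ∫ t in (0 : ℝ)..1, w t * w t = ω u.energy * (∫ t in (0 : ℝ)..1, U t * w t) -
      ∫ t in (0 : ℝ)..1, G t * w t := by
    rw [← intervalIntegral.integral_const_mul, ← intervalIntegral.integral_sub
      (Continuous.intervalIntegrable (by fun_prop) _ _)
      (Continuous.intervalIntegrable (by fun_prop) _ _)]
    exact intervalIntegral.integral_congr fun t _ => by simp only [hw]; ring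
  have hwzero : ∀ t ∈ Icc (0 : ℝ) 1, w t = 0 := fun t ht => mul_self_eq_zero.1
    (eq_zero_of_integral_eq_zero_of_nonneg (w := fun t => w t * w t) (by fun_prop)
      (fun t => mul_self_nonneg _) (by rw [e4, e1, e2, e3]; linarith) t ht)
  have hEmem : u.energy ∈ Ico 0 ρ := ⟨u.energy_nonneg, u.energy_lt⟩
  by_cases hωE : ω u.energy = 0
  · -- In the degenerate case the energy vanishes, so `u = 0`, and the load vanishes as well.
    have hE := hωpos _ hEmem hωE
    have hu0 : ∀ t, u.1 t = 0 := fun t => by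
      have := u.sq_apply_le t
      rw [hE, zero_div] at this
      exact pow_eq_zero_iff two_ne_zero |>.1 (le_antisymm this (sq_nonneg _))
    have hzero : ∀ x : ℝ, HasDerivAt (fun _ : ℝ => (0 : ℝ)) 0 x := fun x => hasDerivAt_const x 0
    have hE0 : dirichletEnergy (fun _ => 0) = 0 := by
      rw [dirichletEnergy_eq hzero]; simp
    refine ⟨fun _ => 0, ⟨contDiffOn_const, fun t => ?_, rfl, rfl, by rwa [hE0]⟩,
      fun t => (hu0 t).symm⟩
    have hGz : EqOn G (fun _ => 0) (Icc 0 1) := fun s hs => by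
      have := hwzero s hs
      simp only [hw, hωE] at this
      linarith
    have h2 := iteratedDerivWithin_two_Icc_eq hG hG' t.2
    rw [iteratedDerivWithin_congr hGz t.2, iteratedDerivWithin_two_Icc_eq hzero hzero t.2] at h2
    have h3 := hgt t
    rw [hu0] at h3
    rw [iteratedDerivWithin_two_Icc_eq hzero hzero t.2]
    linarith
  · set v : ℝ → ℝ := fun t => G t / ω u.energy with hv
    have hvd : ∀ x, HasDerivAt v (G' x / ω u.energy) x := fun x => (hG x).div_const _
    have hvd' : ∀ x, HasDerivAt (fun t => G' t / ω u.energy) (-g x / ω u.energy) x :=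
      fun x => (hG' x).div_const _
    have hvd'' : Continuous fun x => -g x / ω u.energy := by fun_prop
    have hvU : EqOn v U (Icc 0 1) := fun t ht => by
      have := hwzero t ht
      simp only [hw, hv] at this ⊢
      field_simp
      linarith
    have hvu : ∀ t : unitInterval, v t = u.1 t := fun t => (hvU t.2).trans (extendLine_coe _ t)
    have hvE : dirichletEnergy v = u.energy := by
      rw [dirichletEnergy_eq hvd, ← weakEnergy_eq_integral_sq hvd hvd' hvd'' (by simp [hv, hG0])
        (by simp [hv, hG1]), weakEnergy, energyDual_congr hvU]
      rfl
    refine ⟨v, ⟨(contDiff_two_of_hasDerivAt hvd hvd' hvd'').contDiffOn, fun t => ?_,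
      by simp [hv, hG0], by simp [hv, hG1], by rw [hvE]; exact u.energy_lt⟩, hvu⟩
    rw [hvE, iteratedDerivWithin_two_Icc_eq hvd hvd' t.2, hgt, hvu]
    field_simp
    ring

end Functional

/-! ### Multiplicity when `f` is not constant -/

/-- If a primitive of `f` is midpoint affine on `(-R, R)`, then `f` is constant on `[-R, R]`: compare
the derivatives of both sides in `y` at `x = -y`. -/
theorem eq_apply_zero_of_midpoint_affine {f F : ℝ → ℝ} {R : ℝ} (hR : 0 < R) (hf : Continuous f)
    (hF : ∀ x, HasDerivAt F (f x) x)
    (h : ∀ x ∈ Ioo (-R) R, ∀ y ∈ Ioo (-R) R, F ((x + y) / 2) = (F x + F y) / 2) :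
    ∀ y ∈ Icc (-R) R, f y = f 0 := by
  have hIoo : EqOn f (fun _ => f 0) (Ioo (-R) R) := by
    intro y hy
    have hy' : -y ∈ Ioo (-R) R := ⟨by linarith [hy.2], by linarith [hy.1]⟩
    have h1 : HasDerivAt (fun z => F ((-y + z) / 2)) (f 0 * (1 / 2)) y := by
      have e : HasDerivAt (fun z => (-y + z) / 2) (1 / 2) y :=
        ((hasDerivAt_id y).const_add (-y)).div_const 2
      have h2 := hF ((-y + y) / 2)
      rw [show (-y + y) / 2 = 0 by ring] at h2
      exact HasDerivAt.comp y (by rwa [show (-y + y) / 2 = 0 by ring]) e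
    have h3 : HasDerivAt (fun z => (F (-y) + F z) / 2) (f y / 2) y :=
      ((hF y).const_add _).div_const 2
    have h4 : (fun z => F ((-y + z) / 2)) =ᶠ[𝓝 y] fun z => (F (-y) + F z) / 2 := by
      filter_upwards [Ioo_mem_nhds hy.1 hy.2] with z hz
      exact h _ hy' _ hz
    have h5 := h1.unique (h3.congr_of_eventuallyEq h4)
    simp only
    linarith
  have hcl := hIoo.closure hf continuous_const
  rwa [closure_Ioo (by linarith)] at hcl

theorem four_mul_sq_lt_of_mem_Ioo {ρ x : ℝ} (hρ : 0 < ρ) (hx : x ∈ Ioo (-(√ρ / 2)) (√ρ / 2)) :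
    4 * x ^ 2 < ρ := by
  have h1 := Real.sq_sqrt hρ.le
  nlinarith [hx.1, hx.2]

/-- If `f` is not constant on `[-√ρ/2, √ρ/2]`, the graph `{(u, F ∘ u)}` over the energy ball is not
convex. A point of its convex hull outside of it makes the two sides of the minimax equality
different, so some functional with parameter in `S` has two global minimizers. -/
theorem exists_two_solutions {f ω : ℝ → ℝ} {ρ : ℝ} (hf : Continuous f) (hρ : 0 < ρ)
    (hω : ContinuousOn ω (Ico 0 ρ)) (hω0 : ∀ x ∈ Ico 0 ρ, 0 ≤ ω x)
    (hωpos : ∀ x ∈ Ico 0 ρ, ω x = 0 → x = 0)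
    (hlim : Tendsto (fun ξ : ℝ => ∫ x in (0 : ℝ)..ξ, ω x) (𝓝[<] ρ) atTop)
    (hfc : ¬ ∃ c : ℝ, ∀ x ∈ Icc (-(√ρ / 2)) (√ρ / 2), f x = c)
    {S : Set (C(unitInterval, ℝ) × C(unitInterval, ℝ))} (hS : Convex ℝ S) (hSd : L1Dense S) :
    ∃ α β : C(unitInterval, ℝ), (α, β) ∈ S ∧
      ∃ u v : ℝ → ℝ, IsKirchhoffSolution f ω ρ α β u ∧ IsKirchhoffSolution f ω ρ α β v ∧
        ∃ t ∈ Icc (0 : ℝ) 1, u t ≠ v t := by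
  have hFd : ∀ x, HasDerivAt (fun x => ∫ s in (0 : ℝ)..x, f s) (f x) x := fun x =>
    (hf.integral_hasStrictDerivAt 0 x).hasDerivAt
  let F : C(ℝ, ℝ) := ⟨fun x => ∫ s in (0 : ℝ)..x, f s,
    continuous_iff_continuousAt.2 fun x => (hFd x).continuousAt⟩
  have hF : ∀ x, HasDerivAt F (f x) x := hFd
  have hR : 0 < √ρ / 2 := by positivity
  obtain ⟨x₁, hx₁, x₂, hx₂, hne⟩ : ∃ x ∈ Ioo (-(√ρ / 2)) (√ρ / 2),
      ∃ y ∈ Ioo (-(√ρ / 2)) (√ρ / 2), F ((x + y) / 2) ≠ (F x + F y) / 2 := by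
    by_contra! h
    exact hfc ⟨f 0, eq_apply_zero_of_midpoint_affine hR hf hF h⟩
  obtain ⟨u₁, hu₁⟩ := EnergyBall.exists_apply_half_eq (four_mul_sq_lt_of_mem_Ioo hρ hx₁)
  obtain ⟨u₂, hu₂⟩ := EnergyBall.exists_apply_half_eq (four_mul_sq_lt_of_mem_Ioo hρ hx₂)
  set a : C(unitInterval, ℝ) := (1 / 2 : ℝ) • (u₁.1 + u₂.1) with ha
  set b : C(unitInterval, ℝ) := (1 / 2 : ℝ) • (F.comp u₁.1 + F.comp u₂.1) with hb
  have hsplit : ∀ (u : EnergyBall ρ) y, (-loadPairing (u.1 - a) (F.comp u.1 - b)) y =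
      loadPairing a b y - loadPairing u.1 (F.comp u.1) y := by
    intro u y
    simp only [LinearMap.neg_apply, loadPairing_apply]
    rw [← integral_sub (integrable_of_continuous_unitInterval (by fun_prop))
      (integrable_of_continuous_unitInterval (by fun_prop)), ← integral_neg]
    congr 1
    ext t
    simp only [ContinuousMap.sub_apply]
    ring
  have hab : ∀ y, loadPairing a b y =
      (loadPairing u₁.1 (F.comp u₁.1) y + loadPairing u₂.1 (F.comp u₂.1) y) / 2 := by
    intro y
    simp only [loadPairing_apply]
    rw [← integral_add (integrable_of_continuous_unitInterval (by fun_prop))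
      (integrable_of_continuous_unitInterval (by fun_prop)), ← integral_div]
    congr 1
    ext t
    simp only [ha, hb, ContinuousMap.smul_apply, ContinuousMap.add_apply, smul_eq_mul]
    ring
  have hSne : S.Nonempty := (hSd 0 1 one_pos).imp fun q hq => hq.1
  have : Nonempty (EnergyBall ρ) := ⟨u₁⟩
  by_contra hcon
  set c := (kirchhoffPotential ω u₁.energy / 2 + kirchhoffPotential ω u₂.energy / 2) / 2 with hc
  obtain ⟨u, hu⟩ := exists_forall_le_of_unique_min (X := EnergyBall ρ) (S := S)
    (I := fun u => kirchhoffPotential ω u.energy / 2)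
    (ℓ := fun u => -loadPairing (u.1 - a) (F.comp u.1 - b)) (c := c) hS hSne
    (fun y _ r => isCompact_functional_le hρ hω hω0 hlim F a b y r) (by
      intro y hy u v hu hv
      simp only [hsplit] at hu hv
      obtain ⟨u', hu', huu'⟩ := exists_isKirchhoffSolution_of_isMin (u := u) (y := y) hf hρ hω hω0
        hωpos hF fun z => by linarith [hu z]
      obtain ⟨v', hv', hvv'⟩ := exists_isKirchhoffSolution_of_isMin (u := v) (y := y) hf hρ hω hω0
        hωpos hF fun z => by linarith [hv z]
      by_contra huv
      refine hcon ⟨y.1, y.2, hy, u', v', hu', hv', ?_⟩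
      by_contra! h
      refine huv (Subtype.ext (ContinuousMap.ext fun t => ?_))
      rw [← huu', ← hvv', h t t.2]) (by
      intro y _
      simp only [hsplit, hab]
      -- The average over `u₁` and `u₂` of the values of the functional is exactly `c`.
      by_contra! h
      linarith [h u₁, h u₂])
  obtain ⟨hp, hq⟩ := eq_zero_of_bddBelow_loadPairing hSd (p := u.1 - a) (q := F.comp u.1 - b)
    (C := kirchhoffPotential ω u.energy / 2 - c) fun y hy => by
      have := hu y hy
      rw [LinearMap.neg_apply] at this
      linarith
  have h1 := congrArg (fun w : C(unitInterval, ℝ) => w ⟨1 / 2, by norm_num, by norm_num⟩) hp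
  have h2 := congrArg (fun w : C(unitInterval, ℝ) => w ⟨1 / 2, by norm_num, by norm_num⟩) hq
  simp only [ha, hb, ContinuousMap.sub_apply, ContinuousMap.smul_apply, ContinuousMap.add_apply,
    ContinuousMap.comp_apply, ContinuousMap.zero_apply, smul_eq_mul, hu₁, hu₂] at h1 h2
  apply hne
  rw [show (x₁ + x₂) / 2 = u.1 ⟨1 / 2, by norm_num, by norm_num⟩ by linarith]
  linarith

/-! ### Uniqueness when `f` is constant -/

section Uniqueness

variable {u v : ℝ → ℝ}

theorem hasDerivWithinAt_derivWithin (hu : ContDiffOn ℝ 2 u (Icc 0 1)) {t : ℝ}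
    (ht : t ∈ Icc (0 : ℝ) 1) : HasDerivWithinAt u (derivWithin u (Icc 0 1) t) (Icc 0 1) t :=
  (hu.differentiableOn two_ne_zero t ht).hasDerivWithinAt

theorem continuousOn_derivWithin_Icc (hu : ContDiffOn ℝ 2 u (Icc 0 1)) :
    ContinuousOn (derivWithin u (Icc 0 1)) (Icc 0 1) :=
  hu.continuousOn_derivWithin (uniqueDiffOn_Icc zero_lt_one) one_le_two

theorem sq_le_dirichletEnergy (hu : ContDiffOn ℝ 2 u (Icc 0 1)) (h0 : u 0 = 0) (h1 : u 1 = 0)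
    {t : ℝ} (ht : t ∈ Icc (0 : ℝ) 1) : u t ^ 2 ≤ dirichletEnergy u / 4 := by
  have hc := continuousOn_derivWithin_Icc hu
  refine sq_le_of_energyDual_le (fun h => ?_) h0 ht
  have := energyDual_le_integral_sq (v := derivWithin u (Icc 0 1)) hu.continuousOn
    (fun x hx => ((hasDerivWithinAt_derivWithin hu (Ioo_subset_Icc_self hx)).hasDerivAt
      (Icc_mem_nhds hx.1 hx.2)).hasDerivWithinAt)
    (ContinuousOn.intervalIntegrable (by rwa [uIcc_of_le zero_le_one]))
    (ContinuousOn.intervalIntegrable (by rw [uIcc_of_le zero_le_one]; exact hc.pow 2)) h0 h1 h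
  simpa only [dirichletEnergy, sq_abs] using this

theorem eqOn_zero_of_iteratedDerivWithin_two (hu : ContDiffOn ℝ 2 u (Icc 0 1))
    (h : ∀ t ∈ Icc (0 : ℝ) 1, iteratedDerivWithin 2 u (Icc 0 1) t = 0) (h0 : u 0 = 0)
    (h1 : u 1 = 0) : ∀ t ∈ Icc (0 : ℝ) 1, u t = 0 := by
  have hd : DifferentiableOn ℝ (derivWithin u (Icc 0 1)) (Icc 0 1) :=
    (hu.derivWithin (m := 1) (uniqueDiffOn_Icc zero_lt_one) (by norm_num)).differentiableOn
      one_ne_zero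
  have hconst := constant_of_derivWithin_zero hd fun t ht => by
    have := h t (Ico_subset_Icc_self ht)
    rwa [iteratedDerivWithin_succ, iteratedDerivWithin_one] at this
  set m := derivWithin u (Icc 0 1) 0 with hm
  have hlin : ∀ t ∈ Icc (0 : ℝ) 1, u t - m * t = 0 := by
    have hw : ∀ t ∈ Icc (0 : ℝ) 1,
        HasDerivWithinAt (fun t => u t - m * t) 0 (Icc 0 1) t := by
      intro t ht
      have h2 := (hasDerivWithinAt_derivWithin hu ht).sub
        ((hasDerivWithinAt_id t (Icc (0 : ℝ) 1)).const_mul m)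
      rw [hconst t ht] at h2
      exact h2.congr_deriv (by ring)
    have h3 := constant_of_derivWithin_zero (f := fun t => u t - m * t)
      (fun t ht => (hw t ht).differentiableWithinAt) fun t ht =>
      (hw t (Ico_subset_Icc_self ht)).derivWithin
        (uniqueDiffOn_Icc zero_lt_one t (Ico_subset_Icc_self ht))
    intro t ht
    rw [h3 t ht, h0]
    ring
  have hm0 := hlin 1 ⟨zero_le_one, le_rfl⟩
  intro t ht
  have := hlin t ht
  rw [h1] at hm0
  have hm' : m = 0 := by linarith
  rw [hm'] at this
  linarith

theorem dirichletEnergy_smul_congr {a b : ℝ} (hu : ContDiffOn ℝ 2 u (Icc 0 1))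
    (hv : ContDiffOn ℝ 2 v (Icc 0 1)) (h : ∀ t ∈ Icc (0 : ℝ) 1, a * u t = b * v t) :
    a ^ 2 * dirichletEnergy u = b ^ 2 * dirichletEnergy v := by
  simp only [dirichletEnergy]
  rw [← intervalIntegral.integral_const_mul, ← intervalIntegral.integral_const_mul]
  refine intervalIntegral.integral_congr fun t ht => ?_
  rw [uIcc_of_le zero_le_one] at ht
  have h1 := (hasDerivWithinAt_derivWithin hu ht).const_mul a
  have h2 := (hasDerivWithinAt_derivWithin hv ht).const_mul b
  have h3 := (uniqueDiffOn_Icc zero_lt_one t ht).eq_deriv _ h1 (h2.congr h (h t ht))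
  simp only [sq_abs]
  rw [← mul_pow, ← mul_pow, h3]

/-- When `f` is constant on the range of the admissible functions, two solutions `u`, `v` satisfy
`ω(E u) u = ω(E v) v`, hence `ω(E u)² E u = ω(E v)² E v`, and monotonicity of `ω` gives
`E u = E v`. -/
theorem eqOn_of_isKirchhoffSolution {f ω : ℝ → ℝ} {ρ c : ℝ} (hω0 : ∀ x ∈ Ico 0 ρ, 0 ≤ ω x)
    (hωmono : MonotoneOn ω (Ico 0 ρ)) (hωpos : ∀ x ∈ Ico 0 ρ, ω x = 0 → x = 0)
    (hf : ∀ x ∈ Icc (-(√ρ / 2)) (√ρ / 2), f x = c) {α β : C(unitInterval, ℝ)}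
    (hu : IsKirchhoffSolution f ω ρ α β u) (hv : IsKirchhoffSolution f ω ρ α β v) :
    EqOn u v (Icc 0 1) := by
  wlog hle : dirichletEnergy u ≤ dirichletEnergy v generalizing u v
  · exact (this hv hu (not_le.1 hle).le).symm
  have hE : ∀ w, 0 ≤ dirichletEnergy w := fun w =>
    intervalIntegral.integral_nonneg zero_le_one fun t _ => sq_nonneg _
  have hrange : ∀ {w : ℝ → ℝ}, IsKirchhoffSolution f ω ρ α β w → ∀ t : unitInterval,
      f (w t) = c := by
    intro w hw t
    have h1 := sq_le_dirichletEnergy hw.contDiffOn hw.left_zero hw.right_zero t.2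
    have hρ : 0 ≤ ρ := (hE w).trans hw.energy_lt.le
    have h2 : w t ^ 2 ≤ (√ρ / 2) ^ 2 := by
      rw [div_pow, Real.sq_sqrt hρ]
      linarith [hw.energy_lt]
    exact hf _ (abs_le.1 (abs_le_of_sq_le_sq h2 (by positivity)))
  have hmu : dirichletEnergy u ∈ Ico 0 ρ := ⟨hE u, hu.energy_lt⟩
  have hmv : dirichletEnergy v ∈ Ico 0 ρ := ⟨hE v, hv.energy_lt⟩
  set a := ω (dirichletEnergy u) with ha
  set b := ω (dirichletEnergy v) with hb
  have hab : a ≤ b := hωmono hmu hmv hle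
  have ha0 : 0 ≤ a := hω0 _ hmu
  have hprop : ∀ t ∈ Icc (0 : ℝ) 1, a * u t = b * v t := by
    have hau : ContDiffOn ℝ 2 (fun t => a * u t) (Icc 0 1) := contDiffOn_const.mul hu.contDiffOn
    have hbv : ContDiffOn ℝ 2 (fun t => b * v t) (Icc 0 1) := contDiffOn_const.mul hv.contDiffOn
    intro t ht
    refine sub_eq_zero.1 (eqOn_zero_of_iteratedDerivWithin_two (hau.sub hbv) (fun s hs => ?_)
      (by simp [hu.left_zero, hv.left_zero]) (by simp [hu.right_zero, hv.right_zero]) t ht)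
    have hU := uniqueDiffOn_Icc (zero_lt_one' ℝ)
    have e1 := hu.equation ⟨s, hs⟩
    have e2 := hv.equation ⟨s, hs⟩
    rw [hrange hu ⟨s, hs⟩] at e1
    rw [hrange hv ⟨s, hs⟩] at e2
    simp only at e1 e2
    change iteratedDerivWithin 2 ((fun t => a * u t) - fun t => b * v t) (Icc 0 1) s = 0
    rw [iteratedDerivWithin_sub hs hU (hau s hs) (hbv s hs),
      iteratedDerivWithin_const_mul hs hU _ (hu.contDiffOn s hs),
      iteratedDerivWithin_const_mul hs hU _ (hv.contDiffOn s hs)]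
    linarith
  have hsq := dirichletEnergy_smul_congr hu.contDiffOn hv.contDiffOn hprop
  have hzero : ∀ {w : ℝ → ℝ}, IsKirchhoffSolution f ω ρ α β w → dirichletEnergy w = 0 →
      ∀ t ∈ Icc (0 : ℝ) 1, w t = 0 := by
    intro w hw hw0 t ht
    have := sq_le_dirichletEnergy hw.contDiffOn hw.left_zero hw.right_zero ht
    rw [hw0, zero_div] at this
    exact pow_eq_zero_iff two_ne_zero |>.1 (le_antisymm this (sq_nonneg _))
  intro t ht
  rcases ha0.eq_or_lt with ha' | ha'
  · rw [hzero hu (hωpos _ hmu ha'.symm) t ht]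
    have h1 := hprop t ht
    rw [← ha', zero_mul] at h1
    rcases mul_eq_zero.1 h1.symm with hb' | hv'
    · exact (hzero hv (hωpos _ hmv hb') t ht).symm
    · exact hv'.symm
  · have h1 : a ^ 2 * dirichletEnergy v ≤ b ^ 2 * dirichletEnergy v :=
      mul_le_mul_of_nonneg_right (pow_le_pow_left₀ ha0 hab 2) (hE v)
    have h2 : dirichletEnergy v ≤ dirichletEnergy u :=
      le_of_mul_le_mul_left (h1.trans hsq.ge) (by positivity)
    have h3 : a = b := by rw [ha, hb, le_antisymm hle h2]
    have h4 := hprop t ht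
    rw [← h3] at h4
    exact mul_left_cancel₀ ha'.ne' h4

end Uniqueness

theorem theorem2p10 (f : ℝ → ℝ) (hf : Continuous f) (ρ : ℝ) (hρ : 0 < ρ)
    (ω : ℝ → ℝ) (hω_cont : ContinuousOn ω (Ico 0 ρ))
    (hω_nonneg : ∀ x ∈ Ico 0 ρ, 0 ≤ ω x)
    (hω_mono : MonotoneOn ω (Ico 0 ρ))
    (hω_pos : ∀ x ∈ Ico 0 ρ, ω x = 0 → x = 0)
    (hω_lim : Tendsto (fun ξ : ℝ => ∫ x in (0 : ℝ)..ξ, ω x) (𝓝[<] ρ) atTop) :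
    (¬ ∃ c : ℝ, ∀ x ∈ Icc (-(√ρ / 2)) (√ρ / 2), f x = c) ↔
    (∀ S : Set (C(unitInterval, ℝ) × C(unitInterval, ℝ)), Convex ℝ S → L1Dense S →
      ∃ α β : C(unitInterval, ℝ), (α, β) ∈ S ∧
        ∃ u v : ℝ → ℝ, IsKirchhoffSolution f ω ρ α β u ∧ IsKirchhoffSolution f ω ρ α β v ∧
          ∃ t ∈ Icc (0 : ℝ) 1, u t ≠ v t) := by
  refine ⟨fun hfc S hS hSd =>
    exists_two_solutions hf hρ hω_cont hω_nonneg hω_pos hω_lim hfc hS hSd, ?_⟩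
  rintro h ⟨c, hc⟩
  obtain ⟨α, β, -, u, v, hu, hv, t, ht, hne⟩ := h univ convex_univ
    fun p ε hε => ⟨p, mem_univ _, by simpa [l1Norm] using hε⟩
  exact hne (eqOn_of_isKirchhoffSolution hω_nonneg hω_mono hω_pos hc hu hv ht)
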